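/- Let $s\ge 1$ be an integer and $q_2=x_1^2+x_2^2$. A decomposition of size $m$ of $q_2^s$ is an expression $q_2^s=\sum_{j=1}^m \ell_j^{2s}$ with complex linear forms $\ell_j=a_{j,1}x_1+a_{j,2}x_2$; it is minimal if $q_2^s$ has no decomposition of smaller size. Put $$r=2\,(s+1)^{-\frac1{2s}}\binom{2s}{s}^{-\frac1{2s}},\qquad \tau_j=\frac{(j-1)\pi}{s+1}\quad(j=1,\dots,s+1).$$ Then $$q_2^s=\sum_{j=1}^{s+1}\bigl(r\cos(\tau_j)\,x_1+r\sin(\tau_j)\,x_2\bigr)^{2s},$$ this decomposition is minimal, and the points $\pm(r\cos\tau_j,r\sin\tau_j)$ are the vertices of a regular $2(s+1)$-gon inscribed in the circle of radius $r$ centred at the origin. Moreover, it is the unique minimal decomposition of $q_2^s$ up to complex orthogonal transformations: an expression $\sum_{j=1}^m\ell_j^{2s}$ with complex linear forms $\ell_j$ is a minimal decomposition of $q_2^s$ if and only if $m=s+1$ and there is $A\in\mathrm{O}_2(\mathbb{C})$ such that, up to the order of the summands, $\ell_j^{2s}=A\cdot\bigl(r\cos(\tau_j)\,x_1+r\sin(\tau_j)\,x_2\bigr)^{2s}$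 for all $j$. Here $\mathrm{O}_2(\mathbb{C})=\{A\in\mathbb{C}^{2\times 2}: A^{\mathsf T}A=I\}$ acts on polynomials by the linear change of variables $A\cdot x_j=\sum_k A_{kj}x_k$. -/

import Mathlib

noncomputable section

/-- The linear form `l_a = a₁ x₁ + ⋯ + aₙ xₙ` with point `a ∈ ℂⁿ`. -/
def linForm {n : ℕ} (a : Fin n → ℂ) : MvPolynomial (Fin n) ℂ :=
  ∑ i, MvPolynomial.C (a i) * MvPolynomial.X i

/-- The quadratic form `q_n = x₁² + ⋯ + xₙ²`. -/
def quadForm (n : ℕ) : MvPolynomial (Fin n) ℂ :=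
  ∑ i, MvPolynomial.X i ^ 2

/-- The points `a₁, …, a_m` give a (complex Waring) decomposition of size `m` of the degree-`d`
form `f`, that is, `f = ∑ⱼ l_{aⱼ}ᵈ`. -/
def IsDecomposition {n m : ℕ} (d : ℕ) (f : MvPolynomial (Fin n) ℂ)
    (a : Fin m → Fin n → ℂ) : Prop :=
  f = ∑ j, linForm (a j) ^ d

/-- A decomposition is minimal if no decomposition of the same form has smaller size, i.e. if its
size is the Waring rank of the form. -/
def IsMinimalDecomposition {n m : ℕ} (d : ℕ) (f : MvPolynomial (Fin n) ℂ)
    (a : Fin m → Fin n → ℂ) : Prop :=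
  IsDecomposition d f a ∧
    ∀ (m' : ℕ) (b : Fin m' → Fin n → ℂ), IsDecomposition d f b → m ≤ m'

/-- The action of a matrix on polynomials by the linear change of variables
`A · x_j = ∑ₖ A_{kj} x_k`, so that `A · l_a = l_{A a}`. -/
def matrixAct {n : ℕ} (A : Matrix (Fin n) (Fin n) ℂ) (f : MvPolynomial (Fin n) ℂ) :
    MvPolynomial (Fin n) ℂ :=
  MvPolynomial.aeval
    (fun j => ∑ k, MvPolynomial.C (A k j) * MvPolynomial.X k : Fin n → MvPolynomial (Fin n) ℂ) f

/-- The radius `r = 2 (s+1)^{-1/(2s)} C(2s,s)^{-1/(2s)}`. -/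
def polygonRadius (s : ℕ) : ℝ :=
  2 * ((s : ℝ) + 1) ^ (-(1 / (2 * (s : ℝ)))) *
    ((Nat.choose (2 * s) s : ℕ) : ℝ) ^ (-(1 / (2 * (s : ℝ))))

/-- The `k`-th vertex of the regular `N`-gon inscribed in the circle of radius `ρ` centred at the
origin of `ℝ²`, with first vertex `(ρ, 0)`. -/
def regularPolygonVertex (N : ℕ) (ρ : ℝ) (k : ℕ) : Fin 2 → ℝ :=
  ![ρ * Real.cos (2 * Real.pi * k / N), ρ * Real.sin (2 * Real.pi * k / N)]

/-- The real point `(r cos τ_j, r sin τ_j)`, where `τ_j = j π / (s+1)` and `j = 0, …, s`. -/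
def polygonPoint (s : ℕ) (j : Fin (s + 1)) : Fin 2 → ℝ :=
  ![polygonRadius s * Real.cos ((j : ℕ) * Real.pi / ((s : ℝ) + 1)),
    polygonRadius s * Real.sin ((j : ℕ) * Real.pi / ((s : ℝ) + 1))]

/-- A real point regarded as a complex point. -/
def toComplexPoint {n : ℕ} (a : Fin n → ℝ) : Fin n → ℂ := fun i => (a i : ℂ)

end

/-! With `u = x₁ + i x₂` and `v = x₁ - i x₂` one has `q₂ = uv`. Writing `ℓ_j = α_j u + β_j v`, a
decomposition of `q₂ˢ` amounts to the moment equations `∑ α_j^k β_j^(2s-k) = δ_{ks} / binom(2s,s)`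
(`isDecomposition_quadForm_two_pow_iff`). They say that the matrix of degree-`s` monomials at the
points has an explicit left inverse (`isoVandermonde_transpose_mul`), so its rank `s + 1` is at most
`m`.

If `m = s + 1` the matrix is square and the inverse is two-sided. Its diagonal entries fix `(α_j
β_j)^s`; the off-diagonal ones are geometric sums whose vanishing makes the ratios `α_j / β_j` the
`s + 1` distinct solutions of `z^(s+1) = c`. A rotation multiplies `α` by `t` and `β` by `t⁻¹`,
hence carries the polygon's ratios to these, and ratio and `(αβ)^s` together determine `ℓ^(2s)`
(`linForm_pow_eq`). -/

/-! ### Isotropic coordinates and the moment equations -/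

/-- The coefficient of `x₁ + i x₂` in the linear form with point `a ∈ ℂ²`. -/
noncomputable def isoFst (a : Fin 2 → ℂ) : ℂ := (a 0 - Complex.I * a 1) / 2

/-- The coefficient of `x₁ - i x₂` in the linear form with point `a ∈ ℂ²`. -/
noncomputable def isoSnd (a : Fin 2 → ℂ) : ℂ := (a 0 + Complex.I * a 1) / 2

/-- The isotropic form `x₁ + i x₂`. -/
noncomputable def isoU : MvPolynomial (Fin 2) ℂ :=
  MvPolynomial.X 0 + MvPolynomial.C Complex.I * MvPolynomial.X 1

/-- The isotropic form `x₁ - i x₂`. -/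
noncomputable def isoV : MvPolynomial (Fin 2) ℂ :=
  MvPolynomial.X 0 - MvPolynomial.C Complex.I * MvPolynomial.X 1

theorem C_I_mul_C_I {σ : Type*} :
    (MvPolynomial.C Complex.I * MvPolynomial.C Complex.I : MvPolynomial σ ℂ) = -1 := by
  rw [← MvPolynomial.C_mul, Complex.I_mul_I]; simp

theorem quadForm_two_eq : quadForm 2 = isoU * isoV := by
  have h := C_I_mul_C_I (σ := Fin 2)
  simp only [quadForm, isoU, isoV, Fin.sum_univ_two]
  linear_combination ((MvPolynomial.X 1) ^ 2 : MvPolynomial (Fin 2) ℂ) * h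

theorem isoFst_add_isoSnd (a : Fin 2 → ℂ) : isoFst a + isoSnd a = a 0 := by
  simp only [isoFst, isoSnd]; ring

theorem I_mul_isoFst_sub_isoSnd (a : Fin 2 → ℂ) :
    Complex.I * (isoFst a - isoSnd a) = a 1 := by
  simp only [isoFst, isoSnd]
  linear_combination (-a 1) * Complex.I_mul_I

theorem linForm_eq_iso (a : Fin 2 → ℂ) :
    linForm a = MvPolynomial.C (isoFst a) * isoU + MvPolynomial.C (isoSnd a) * isoV := by
  simp only [linForm, Fin.sum_univ_two, isoU, isoV]
  rw [← I_mul_isoFst_sub_isoSnd a, ← isoFst_add_isoSnd a]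
  simp only [MvPolynomial.C_add, MvPolynomial.C_sub, MvPolynomial.C_mul]
  ring

/-- Dehomogenization with respect to the isotropic coordinates: `x₁ + i x₂ ↦ T`,
`x₁ - i x₂ ↦ 1`. -/
noncomputable def isoDehom : MvPolynomial (Fin 2) ℂ →ₐ[ℂ] Polynomial ℂ :=
  MvPolynomial.aeval
    ![Polynomial.C (1 / 2) * (Polynomial.X + 1),
      Polynomial.C (-Complex.I / 2) * (Polynomial.X - 1)]

theorem C_I_mul_C_neg_I_div_two :
    (Polynomial.C Complex.I * Polynomial.C (-Complex.I / 2) : Polynomial ℂ) =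
      Polynomial.C (1 / 2) := by
  rw [← Polynomial.C_mul]
  congr 1
  linear_combination (-1 / 2 : ℂ) * Complex.I_mul_I

theorem C_half_add_C_half :
    (Polynomial.C (1 / 2) + Polynomial.C (1 / 2) : Polynomial ℂ) = 1 := by
  rw [← Polynomial.C_add]; norm_num

theorem isoDehom_C (c : ℂ) : isoDehom (MvPolynomial.C c) = Polynomial.C c := by
  simp [isoDehom]

theorem isoDehom_isoU : isoDehom isoU = Polynomial.X := by
  have h1 := C_I_mul_C_neg_I_div_two
  have h2 := C_half_add_C_half
  simp only [isoU, map_add, map_mul, isoDehom_C]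
  simp only [isoDehom, MvPolynomial.aeval_X, Matrix.cons_val_zero, Matrix.cons_val_one]
  linear_combination (Polynomial.X - 1) * h1 + Polynomial.X * h2

theorem isoDehom_isoV : isoDehom isoV = 1 := by
  have h1 := C_I_mul_C_neg_I_div_two
  have h2 := C_half_add_C_half
  simp only [isoV, map_sub, map_mul, isoDehom_C]
  simp only [isoDehom, MvPolynomial.aeval_X, Matrix.cons_val_zero, Matrix.cons_val_one]
  linear_combination (1 - Polynomial.X) * h1 + h2

theorem sum_linForm_pow {m : ℕ} (d : ℕ) (a : Fin m → Fin 2 → ℂ) :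
    ∑ j, linForm (a j) ^ d =
      ∑ k ∈ Finset.range (d + 1),
        MvPolynomial.C ((∑ j, isoFst (a j) ^ k * isoSnd (a j) ^ (d - k)) * (d.choose k : ℂ)) *
          (isoU ^ k * isoV ^ (d - k)) := by
  simp only [linForm_eq_iso, add_pow, Finset.sum_mul, map_sum]
  rw [Finset.sum_comm]
  refine Finset.sum_congr rfl fun k _ => Finset.sum_congr rfl fun j _ => ?_
  simp only [MvPolynomial.C_mul, MvPolynomial.C_pow, map_natCast]
  ring

/-- A decomposition of `q₂ˢ` is the same as a solution of the moment equations in the isotropic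
coordinates. -/
theorem isDecomposition_quadForm_two_pow_iff {m : ℕ} (s : ℕ) (a : Fin m → Fin 2 → ℂ) :
    IsDecomposition (2 * s) (quadForm 2 ^ s) a ↔
      ∀ k ≤ 2 * s, ∑ j, isoFst (a j) ^ k * isoSnd (a j) ^ (2 * s - k) =
        if k = s then ((Nat.choose (2 * s) s : ℕ) : ℂ)⁻¹ else 0 := by
  have hc : ((Nat.choose (2 * s) s : ℕ) : ℂ) ≠ 0 :=
    Nat.cast_ne_zero.mpr (Nat.choose_pos (by omega)).ne'
  unfold IsDecomposition
  rw [sum_linForm_pow, quadForm_two_eq]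
  constructor
  · intro h k hk
    -- Dehomogenizing sends `u^k v^(2s-k)` to `T^k`, so distinct monomials are separated by degree.
    have h' := congrArg (fun f => (isoDehom f).coeff k) h
    simp only [map_pow, map_mul, map_sum, isoDehom_isoU, isoDehom_isoV, isoDehom_C, mul_one,
      one_pow, Polynomial.finsetSum_coeff] at h'
    simp only [← map_pow, ← map_mul, ← map_sum,
      Polynomial.coeff_C_mul, Polynomial.coeff_X_pow, mul_ite, mul_one, mul_zero,
      Finset.sum_ite_eq, Finset.mem_range, Nat.lt_succ_of_le hk, if_true] at h'
    split_ifs at h' ⊢ with hks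
    · rw [hks] at h' ⊢
      exact eq_inv_of_mul_eq_one_left h'.symm
    · have hck : ((Nat.choose (2 * s) k : ℕ) : ℂ) ≠ 0 :=
        Nat.cast_ne_zero.mpr (Nat.choose_pos hk).ne'
      exact (mul_eq_zero.mp h'.symm).resolve_right hck
  · intro h
    rw [Finset.sum_eq_single_of_mem s (Finset.mem_range.mpr (by omega))]
    · rw [h s (by omega), if_pos rfl, inv_mul_cancel₀ hc, MvPolynomial.C_1, one_mul, mul_pow,
        two_mul, Nat.add_sub_cancel]
    · intro k hk hks
      rw [h k (by simpa [Nat.lt_succ_iff] using hk), if_neg hks]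
      simp

/-! ### Lower bound for the size, and orthogonality of the points -/

/-- The matrix of the monomials of degree `s` at the points, in isotropic coordinates. -/
noncomputable def isoVandermonde {m : ℕ} (s : ℕ) (a : Fin m → Fin 2 → ℂ) : Matrix (Fin m) (Fin (s + 1)) ℂ :=
  Matrix.of fun j k => isoFst (a j) ^ (k : ℕ) * isoSnd (a j) ^ (s - k)

/-- The matrix of monomials at the points of a decomposition of `q₂ˢ` has a left inverse: its
transpose, with the rows reversed, times `binom(2s,s)`. -/
theorem isoVandermonde_transpose_mul {m : ℕ} (s : ℕ) (a : Fin m → Fin 2 → ℂ)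
    (h : IsDecomposition (2 * s) (quadForm 2 ^ s) a) :
    (((Nat.choose (2 * s) s : ℕ) : ℂ) •
      (isoVandermonde s a).transpose.submatrix Fin.rev id) * isoVandermonde s a = 1 := by
  have hc : ((Nat.choose (2 * s) s : ℕ) : ℂ) ≠ 0 :=
    Nat.cast_ne_zero.mpr (Nat.choose_pos (by omega)).ne'
  rw [isDecomposition_quadForm_two_pow_iff] at h
  ext k l
  rw [Matrix.smul_mul, Matrix.smul_apply, Matrix.mul_apply, Matrix.one_apply]
  -- Because of the row reversal, entry `(k, l)` is the moment of order `(s - k) + l`, which equals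
  -- `s` exactly when `k = l`.
  have h' := h ((s - k) + l) (by omega)
  have : ∑ j, (isoVandermonde s a).transpose.submatrix Fin.rev id k j * isoVandermonde s a j l =
      ∑ j, isoFst (a j) ^ ((s - k) + l : ℕ) * isoSnd (a j) ^ (2 * s - ((s - k) + l)) := by
    refine Finset.sum_congr rfl fun j _ => ?_
    have e1 : s + 1 - ((k : ℕ) + 1) = s - k := by omega
    have e2 : 2 * s - ((s - k) + l) = (s - (s - k)) + (s - l) := by omega
    simp only [isoVandermonde, Matrix.submatrix_apply, Matrix.transpose_apply, Matrix.of_apply,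
      Fin.val_rev, id, e1, e2, pow_add]
    ring
  rw [this, h', smul_eq_mul]
  by_cases hkl : k = l
  · subst hkl
    rw [if_pos (by omega), if_pos rfl, mul_inv_cancel₀ hc]
  · rw [if_neg (fun h => hkl (Fin.ext (by omega))), if_neg hkl, mul_zero]

/-- An identity matrix of size `s + 1` that factors through `ℂ^m` has rank at most `m`. -/
theorem le_of_isDecomposition {m : ℕ} (s : ℕ) (a : Fin m → Fin 2 → ℂ)
    (h : IsDecomposition (2 * s) (quadForm 2 ^ s) a) : s + 1 ≤ m := by
  have h1 := isoVandermonde_transpose_mul s a h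
  have h2 := Matrix.rank_mul_le_left (((Nat.choose (2 * s) s : ℕ) : ℂ) •
      (isoVandermonde s a).transpose.submatrix Fin.rev id) (isoVandermonde s a)
  rw [h1, Matrix.rank_one, Fintype.card_fin] at h2
  exact h2.trans ((Matrix.rank_le_card_width _).trans (by simp))

/-- The points of a decomposition of size `s + 1` are orthogonal for the apolar form. -/
theorem sum_range_isoFst_isoSnd (s : ℕ) (a : Fin (s + 1) → Fin 2 → ℂ)
    (h : IsDecomposition (2 * s) (quadForm 2 ^ s) a) (i j : Fin (s + 1)) :
    ∑ k ∈ Finset.range (s + 1), (isoFst (a i) * isoSnd (a j)) ^ k *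
        (isoSnd (a i) * isoFst (a j)) ^ (s - k) =
      if i = j then ((Nat.choose (2 * s) s : ℕ) : ℂ)⁻¹ else 0 := by
  have hc : ((Nat.choose (2 * s) s : ℕ) : ℂ) ≠ 0 :=
    Nat.cast_ne_zero.mpr (Nat.choose_pos (by omega)).ne'
  -- Here the size `s + 1` matters: for square matrices a left inverse is a right inverse.
  have h1 := mul_eq_one_comm.mp (isoVandermonde_transpose_mul s a h)
  have h2 := congrFun (congrFun h1 i) j
  rw [Matrix.mul_smul, Matrix.smul_apply, Matrix.mul_apply, Matrix.one_apply, smul_eq_mul] at h2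
  rw [Finset.sum_range]
  have h3 : ∑ k, isoVandermonde s a i k *
      (isoVandermonde s a).transpose.submatrix Fin.rev id k j =
      ∑ k : Fin (s + 1), (isoFst (a i) * isoSnd (a j)) ^ (k : ℕ) *
        (isoSnd (a i) * isoFst (a j)) ^ (s - k) := by
    refine Finset.sum_congr rfl fun k _ => ?_
    have e1 : s + 1 - ((k : ℕ) + 1) = s - k := by omega
    have e2 : s - (s - (k : ℕ)) = k := by omega
    simp only [isoVandermonde, Matrix.submatrix_apply, Matrix.transpose_apply, Matrix.of_apply,
      Fin.val_rev, id, e1, e2, mul_pow]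
    ring
  apply mul_left_cancel₀ hc
  rw [← h3, h2]
  split_ifs
  · rw [mul_inv_cancel₀ hc]
  · rw [mul_zero]

/-! ### Linear changes of variables -/

theorem matrixAct_linForm {n : ℕ} (A : Matrix (Fin n) (Fin n) ℂ) (a : Fin n → ℂ) :
    matrixAct A (linForm a) = linForm (A.mulVec a) := by
  simp only [matrixAct, linForm, map_sum, map_mul, MvPolynomial.aeval_X, MvPolynomial.aeval_C,
    Matrix.mulVec, dotProduct, MvPolynomial.algebraMap_eq, Finset.mul_sum, Finset.sum_mul]
  rw [Finset.sum_comm]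
  refine Finset.sum_congr rfl fun i _ => Finset.sum_congr rfl fun j _ => ?_
  ring

theorem matrixAct_pow {n : ℕ} (A : Matrix (Fin n) (Fin n) ℂ) (f : MvPolynomial (Fin n) ℂ)
    (d : ℕ) : matrixAct A (f ^ d) = matrixAct A f ^ d := map_pow _ _ _

theorem matrixAct_sum {n : ℕ} {ι : Type*} (t : Finset ι) (A : Matrix (Fin n) (Fin n) ℂ)
    (f : ι → MvPolynomial (Fin n) ℂ) :
    matrixAct A (∑ j ∈ t, f j) = ∑ j ∈ t, matrixAct A (f j) := map_sum _ _ _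

theorem matrixAct_quadForm {n : ℕ} {A : Matrix (Fin n) (Fin n) ℂ}
    (hA : A ∈ Matrix.orthogonalGroup (Fin n) ℂ) : matrixAct A (quadForm n) = quadForm n := by
  rw [Matrix.mem_orthogonalGroup_iff] at hA
  simp only [matrixAct, quadForm, map_sum, map_pow, MvPolynomial.aeval_X]
  calc ∑ j, (∑ k, MvPolynomial.C (A k j) * MvPolynomial.X k : MvPolynomial (Fin n) ℂ) ^ 2
      = ∑ k, ∑ l, MvPolynomial.C (∑ j, A k j * A l j) *
          (MvPolynomial.X k * MvPolynomial.X l) := by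
        simp only [sq, Finset.sum_mul_sum]
        rw [Finset.sum_comm]
        refine Finset.sum_congr rfl fun k _ => ?_
        rw [Finset.sum_comm]
        refine Finset.sum_congr rfl fun l _ => ?_
        rw [map_sum, Finset.sum_mul]
        refine Finset.sum_congr rfl fun j _ => ?_
        rw [MvPolynomial.C_mul]; ring
    _ = ∑ k, ∑ l, MvPolynomial.C ((1 : Matrix (Fin n) (Fin n) ℂ) k l) *
          (MvPolynomial.X k * MvPolynomial.X l) := by
        rw [← hA]
        simp [Matrix.mul_apply]
    _ = ∑ k, MvPolynomial.X k ^ 2 := by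
        simp [Matrix.one_apply, sq]

/-! ### The decomposition given by the polygon -/

/-- This is the normalization imposed by the moment of order `s`, to which each of the `s + 1`
points contributes `(r/2)^(2s)`. -/
theorem polygonRadius_pow (s : ℕ) (hs : 1 ≤ s) :
    (polygonRadius s / 2) ^ (2 * s) =
      (((s : ℝ) + 1) * ((Nat.choose (2 * s) s : ℕ) : ℝ))⁻¹ := by
  have hs' : (s : ℝ) ≠ 0 := by positivity
  have key : ∀ x : ℝ, 0 ≤ x → (x ^ (-(1 / (2 * (s : ℝ))))) ^ (2 * s) = x⁻¹ := by
    intro x hx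
    rw [← Real.rpow_natCast, ← Real.rpow_mul hx]
    have : -(1 / (2 * (s : ℝ))) * ((2 * s : ℕ) : ℝ) = -1 := by
      push_cast; field_simp
    rw [this, Real.rpow_neg_one]
  have : polygonRadius s / 2 = ((s : ℝ) + 1) ^ (-(1 / (2 * (s : ℝ)))) *
      ((Nat.choose (2 * s) s : ℕ) : ℝ) ^ (-(1 / (2 * (s : ℝ)))) := by
    unfold polygonRadius; ring
  rw [this, mul_pow, key _ (by positivity), key _ (by positivity), mul_inv]

/-- The primitive `(s+1)`-st root of unity `exp(2πi/(s+1))`. -/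
noncomputable def polygonRoot (s : ℕ) : ℂ := Complex.exp (2 * Real.pi * Complex.I / ((s + 1 : ℕ) : ℂ))

theorem isPrimitiveRoot_polygonRoot (s : ℕ) : IsPrimitiveRoot (polygonRoot s) (s + 1) :=
  Complex.isPrimitiveRoot_exp (s + 1) (Nat.succ_ne_zero s)

/-- The unit `exp(iτ_j)`, `τ_j = jπ/(s+1)`. -/
noncomputable def polygonUnit (s : ℕ) (j : ℕ) : ℂ :=
  Complex.exp ((((j : ℝ) * Real.pi / ((s : ℝ) + 1) : ℝ) : ℂ) * Complex.I)

theorem polygonUnit_ne_zero (s j : ℕ) : polygonUnit s j ≠ 0 := Complex.exp_ne_zero _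

theorem polygonUnit_sq (s j : ℕ) : polygonUnit s j ^ 2 = polygonRoot s ^ j := by
  rw [polygonUnit, polygonRoot, ← Complex.exp_nat_mul, ← Complex.exp_nat_mul]
  congr 1
  push_cast
  ring

theorem isoSnd_polygonPoint (s : ℕ) (j : Fin (s + 1)) :
    isoSnd (toComplexPoint (polygonPoint s j)) =
      ((polygonRadius s / 2 : ℝ) : ℂ) * polygonUnit s j := by
  rw [polygonUnit, Complex.exp_mul_I]
  simp only [isoSnd, toComplexPoint, polygonPoint, Matrix.cons_val_zero, Matrix.cons_val_one]
  push_cast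
  ring

theorem isoFst_polygonPoint (s : ℕ) (j : Fin (s + 1)) :
    isoFst (toComplexPoint (polygonPoint s j)) =
      ((polygonRadius s / 2 : ℝ) : ℂ) * (polygonUnit s j)⁻¹ := by
  rw [polygonUnit, ← Complex.exp_neg, ← neg_mul, Complex.exp_mul_I, Complex.cos_neg,
    Complex.sin_neg]
  simp only [isoFst, toComplexPoint, polygonPoint, Matrix.cons_val_zero, Matrix.cons_val_one]
  push_cast
  ring

theorem polygonRadius_pow_complex (s : ℕ) (hs : 1 ≤ s) :
    ((polygonRadius s / 2 : ℝ) : ℂ) ^ (2 * s) =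
      (((s : ℂ) + 1) * ((Nat.choose (2 * s) s : ℕ) : ℂ))⁻¹ := by
  have := congrArg (fun x : ℝ => (x : ℂ)) (polygonRadius_pow s hs)
  simpa using this

/-- The moment of order `k` is a geometric sum over the powers of `ω^(s-k)`, with `ω` a primitive
`(s+1)`-st root of unity; it vanishes unless the ratio is `1`. -/
theorem isDecomposition_polygonPoint (s : ℕ) (hs : 1 ≤ s) :
    IsDecomposition (2 * s) (quadForm 2 ^ s)
      (fun j : Fin (s + 1) => toComplexPoint (polygonPoint s j)) := by
  rw [isDecomposition_quadForm_two_pow_iff]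
  intro k hk
  have hω := isPrimitiveRoot_polygonRoot s
  have hω0 : polygonRoot s ≠ 0 := hω.ne_zero (Nat.succ_ne_zero s)
  have hz : ∀ j : Fin (s + 1), isoFst (toComplexPoint (polygonPoint s j)) ^ k *
      isoSnd (toComplexPoint (polygonPoint s j)) ^ (2 * s - k) =
      ((polygonRadius s / 2 : ℝ) : ℂ) ^ (2 * s) *
        (polygonRoot s ^ ((s : ℤ) - k)) ^ (j : ℕ) := by
    intro j
    have hu := polygonUnit_ne_zero s j
    have e : polygonUnit s j ^ (2 * s - k) = polygonUnit s j ^ (2 * s) * (polygonUnit s j ^ k)⁻¹ :=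
      pow_sub₀ _ hu hk
    have e' : (polygonRoot s ^ ((s : ℤ) - k)) ^ (j : ℕ) =
        polygonUnit s j ^ (2 * s) * (polygonUnit s j ^ k)⁻¹ * (polygonUnit s j ^ k)⁻¹ := by
      rw [← zpow_natCast, zpow_comm, zpow_natCast, ← polygonUnit_sq, zpow_sub₀ (pow_ne_zero _ hu),
        zpow_natCast, zpow_natCast]
      field_simp
      ring
    rw [isoFst_polygonPoint, isoSnd_polygonPoint, mul_pow, mul_pow, e, e', inv_pow]
    have : ((polygonRadius s / 2 : ℝ) : ℂ) ^ (2 * s) =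
        ((polygonRadius s / 2 : ℝ) : ℂ) ^ k * ((polygonRadius s / 2 : ℝ) : ℂ) ^ (2 * s - k) := by
      rw [← pow_add]; congr 1; omega
    rw [this]
    ring
  rw [Finset.sum_congr rfl fun j _ => hz j, ← Finset.mul_sum,
    ← Finset.sum_range (fun j => (polygonRoot s ^ ((s : ℤ) - k)) ^ j),
    polygonRadius_pow_complex s hs]
  split_ifs with hks
  · subst hks
    have : (k : ℂ) + 1 ≠ 0 := by exact_mod_cast Nat.succ_ne_zero k
    simp only [sub_self, zpow_zero, one_pow, Finset.sum_const, Finset.card_range, nsmul_eq_mul,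
      mul_one]
    push_cast
    field_simp
  -- `s - k` is nonzero of absolute value at most `s`, so `s + 1` does not divide it.
  · have h1 : polygonRoot s ^ ((s : ℤ) - k) ≠ 1 := by
      intro h1
      rw [hω.zpow_eq_one_iff_dvd] at h1
      obtain ⟨c, hc⟩ := h1
      have hc0 : c ≠ 0 := by
        rintro rfl
        omega
      have : (s + 1 : ℤ) ≤ |(s : ℤ) - k| := by
        rw [hc, abs_mul]
        have h2 : (1 : ℤ) ≤ |c| := Int.one_le_abs hc0
        have h3 : |((s + 1 : ℕ) : ℤ)| = s + 1 := by simp; positivity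
        rw [h3]; nlinarith
      have : |(s : ℤ) - k| ≤ s := abs_le.mpr ⟨by omega, by omega⟩
      omega
    rw [geom_sum_eq h1, ← zpow_natCast, zpow_comm, zpow_natCast, hω.pow_eq_one]
    simp

theorem isMinimalDecomposition_iff_isDecomposition {m : ℕ} (s : ℕ) (hs : 1 ≤ s)
    (a : Fin m → Fin 2 → ℂ) :
    IsMinimalDecomposition (2 * s) (quadForm 2 ^ s) a ↔
      IsDecomposition (2 * s) (quadForm 2 ^ s) a ∧ m = s + 1 := by
  constructor
  · rintro ⟨h1, h2⟩
    exact ⟨h1, le_antisymm (h2 _ _ (isDecomposition_polygonPoint s hs))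
      (le_of_isDecomposition s a h1)⟩
  · rintro ⟨h1, rfl⟩
    exact ⟨h1, fun m' b hb => le_of_isDecomposition s b hb⟩

/-! ### Uniqueness up to rotation -/

/-- The rotation of `ℂ²` scaling the isotropic coordinates by `t` and `t⁻¹`. -/
noncomputable def isoRotation (t : ℂ) : Matrix (Fin 2) (Fin 2) ℂ :=
  !![(t + t⁻¹) / 2, -(Complex.I * (t - t⁻¹) / 2); Complex.I * (t - t⁻¹) / 2, (t + t⁻¹) / 2]

theorem isoRotation_mem_orthogonalGroup {t : ℂ} (ht : t ≠ 0) :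
    isoRotation t ∈ Matrix.orthogonalGroup (Fin 2) ℂ := by
  have h : t * t⁻¹ = 1 := mul_inv_cancel₀ ht
  have hI := Complex.I_mul_I
  rw [Matrix.mem_orthogonalGroup_iff]
  ext i j
  fin_cases i <;> fin_cases j <;>
    simp [isoRotation, Matrix.mul_apply, Fin.sum_univ_two]
  · linear_combination h + (t - t⁻¹) ^ 2 / 4 * hI
  · ring
  · ring
  · linear_combination h + (t - t⁻¹) ^ 2 / 4 * hI

theorem isoFst_isoRotation_mulVec (t : ℂ) (a : Fin 2 → ℂ) :
    isoFst ((isoRotation t).mulVec a) = t * isoFst a := by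
  have hI := Complex.I_mul_I
  simp only [isoFst, isoRotation, Matrix.mulVec, dotProduct, Fin.sum_univ_two, Matrix.of_apply,
    Matrix.cons_val_zero, Matrix.cons_val_one]
  linear_combination (-(t - t⁻¹) * a 0 / 4) * hI

theorem isoSnd_isoRotation_mulVec (t : ℂ) (a : Fin 2 → ℂ) :
    isoSnd ((isoRotation t).mulVec a) = t⁻¹ * isoSnd a := by
  have hI := Complex.I_mul_I
  simp only [isoSnd, isoRotation, Matrix.mulVec, dotProduct, Fin.sum_univ_two, Matrix.of_apply,
    Matrix.cons_val_zero, Matrix.cons_val_one]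
  linear_combination ((t - t⁻¹) * a 0 / 4) * hI

/-- Up to sign and roots of unity, a non-isotropic form is determined by the ratio and the product
of its isotropic coordinates. -/
theorem linForm_pow_eq {s : ℕ} {a b : Fin 2 → ℂ} {w : ℂ} (hw : w ≠ 0)
    (ha : isoFst a = w * isoSnd a) (hb : isoFst b = w * isoSnd b)
    (h : (isoFst a * isoSnd a) ^ s = (isoFst b * isoSnd b) ^ s) :
    linForm a ^ (2 * s) = linForm b ^ (2 * s) := by
  have h1 : isoSnd a ^ (2 * s) = isoSnd b ^ (2 * s) := by
    rw [ha, hb] at h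
    apply mul_left_cancel₀ (pow_ne_zero s hw)
    rw [pow_mul, pow_mul, ← mul_pow, ← mul_pow]
    convert h using 2 <;> ring
  have h2 : ∀ c : Fin 2 → ℂ, isoFst c = w * isoSnd c → linForm c ^ (2 * s) =
      MvPolynomial.C (isoSnd c ^ (2 * s)) * (MvPolynomial.C w * isoU + isoV) ^ (2 * s) := by
    intro c hc
    rw [linForm_eq_iso, hc, MvPolynomial.C_pow, ← mul_pow, MvPolynomial.C_mul]
    congr 1
    ring
  rw [h2 a ha, h2 b hb, h1]

/-- Rotations alone suffice: the ratios form a coset of the `(s+1)`-st roots of unity, and `t` moves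
one such coset to another. -/
theorem exists_isoRotation_of_isDecomposition (s : ℕ) (hs : 1 ≤ s) (a : Fin (s + 1) → Fin 2 → ℂ)
    (h : IsDecomposition (2 * s) (quadForm 2 ^ s) a) :
    ∃ t : ℂ, t ≠ 0 ∧ ∃ e : Fin (s + 1) ≃ Fin (s + 1), ∀ j, linForm (a j) ^ (2 * s) =
      linForm ((isoRotation t).mulVec (toComplexPoint (polygonPoint s (e j)))) ^ (2 * s) := by
  have hc : ((Nat.choose (2 * s) s : ℕ) : ℂ) ≠ 0 :=
    Nat.cast_ne_zero.mpr (Nat.choose_pos (by omega)).ne'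
  have hs1 : (s : ℂ) + 1 ≠ 0 := by exact_mod_cast Nat.succ_ne_zero s
  have horth := sum_range_isoFst_isoSnd s a h
  have hsum : ∀ x : ℂ, ∑ k ∈ Finset.range (s + 1), x ^ k * x ^ (s - k) = ((s : ℂ) + 1) * x ^ s := by
    intro x
    rw [Finset.sum_congr rfl (g := fun _ => x ^ s), Finset.sum_const, Finset.card_range,
      nsmul_eq_mul, Nat.cast_add, Nat.cast_one]
    intro k hk
    rw [← pow_add]
    congr 1
    have := Finset.mem_range.mp hk
    omega
  have hprod : ∀ j, (isoFst (a j) * isoSnd (a j)) ^ s =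
      ((polygonRadius s / 2 : ℝ) : ℂ) ^ (2 * s) := by
    intro j
    have h1 := horth j j
    rw [if_pos rfl, mul_comm (isoSnd (a j)), hsum] at h1
    rw [polygonRadius_pow_complex s hs, mul_inv, ← h1, inv_mul_cancel_left₀ hs1]
  have hne : ∀ j, isoFst (a j) * isoSnd (a j) ≠ 0 := by
    intro j h0
    have h1 := hprod j
    rw [h0, zero_pow (by omega), polygonRadius_pow_complex s hs] at h1
    exact inv_ne_zero (mul_ne_zero hs1 hc) h1.symm
  have hF : ∀ j, isoFst (a j) ≠ 0 := fun j => left_ne_zero_of_mul (hne j)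
  have hS : ∀ j, isoSnd (a j) ≠ 0 := fun j => right_ne_zero_of_mul (hne j)
  set z : Fin (s + 1) → ℂ := fun j => isoFst (a j) / isoSnd (a j) with hz
  have hz0 : ∀ j, z j ≠ 0 := fun j => div_ne_zero (hF j) (hS j)
  have hzF : ∀ j, isoFst (a j) = z j * isoSnd (a j) := fun j => (div_mul_cancel₀ _ (hS j)).symm
  have hinj : ∀ i j, z i = z j → i = j := by
    intro i j hij
    by_contra hne'
    have h1 := horth i j
    have h2 : isoFst (a i) * isoSnd (a j) = isoSnd (a i) * isoFst (a j) := by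
      rw [hzF i, hzF j, hij]; ring
    rw [if_neg hne', h2, hsum] at h1
    exact mul_ne_zero hs1 (pow_ne_zero _ (mul_ne_zero (hS i) (hF j))) h1
  have hroot : ∀ j, (z j / z 0) ^ (s + 1) = 1 := by
    intro j
    by_cases hj : j = 0
    · rw [hj, div_self (hz0 0), one_pow]
    -- The vanishing sum times `x - y` is `x^(s+1) - y^(s+1)`, so `x / y` is a root of unity.
    have h1 := geom_sum₂_mul (isoFst (a j) * isoSnd (a 0)) (isoSnd (a j) * isoFst (a 0)) (s + 1)
    rw [Nat.add_sub_cancel, horth j 0, if_neg hj, zero_mul, eq_comm, sub_eq_zero] at h1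
    have h2 : z j / z 0 = (isoFst (a j) * isoSnd (a 0)) / (isoSnd (a j) * isoFst (a 0)) := by
      simp only [hz]
      rw [div_div_div_eq]
    rw [h2, div_pow, h1, div_self (pow_ne_zero _ (mul_ne_zero (hS j) (hF 0)))]
  -- The inverse root appears because the ratio at the `j`-th polygon point is `ω^(-j)`.
  have hω := (isPrimitiveRoot_polygonRoot s).inv
  have hex : ∀ j, ∃ i : Fin (s + 1), (polygonRoot s)⁻¹ ^ (i : ℕ) = z j / z 0 := by
    intro j
    obtain ⟨i, hi, hi'⟩ := hω.eq_pow_of_pow_eq_one (hroot j)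
    exact ⟨⟨i, hi⟩, hi'⟩
  choose f hf using hex
  have hfinj : Function.Injective f := by
    intro i j hij
    apply hinj
    have h1 := hf i
    rw [hij, hf j] at h1
    exact ((div_left_inj' (hz0 0)).mp h1).symm
  -- A square root, since `isoRotation t` multiplies the ratio by `t²`.
  obtain ⟨t, ht⟩ := IsAlgClosed.exists_pow_nat_eq (z 0) (n := 2) (by norm_num)
  have ht0 : t ≠ 0 := by
    rintro rfl
    exact hz0 0 (by rw [← ht]; simp)
  refine ⟨t, ht0, Equiv.ofBijective f (Finite.injective_iff_bijective.mp hfinj), fun j => ?_⟩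
  have hu := polygonUnit_ne_zero s (f j)
  have hzj : z j = t ^ 2 * ((polygonUnit s (f j)) ^ 2)⁻¹ := by
    rw [polygonUnit_sq, ht, ← inv_pow, hf j, mul_div_cancel₀ _ (hz0 0)]
  refine linForm_pow_eq (hz0 j) (hzF j) ?_ ?_
  · rw [isoFst_isoRotation_mulVec, isoSnd_isoRotation_mulVec, Equiv.ofBijective_apply,
      isoFst_polygonPoint, isoSnd_polygonPoint, hzj]
    field_simp
  · rw [isoFst_isoRotation_mulVec, isoSnd_isoRotation_mulVec, Equiv.ofBijective_apply,
      isoFst_polygonPoint, isoSnd_polygonPoint, hprod, pow_mul]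
    congr 1
    field_simp

/-! ### The regular `2(s+1)`-gon and the main theorem -/

theorem regularPolygonVertex_of_lt (s : ℕ) (j : Fin (s + 1)) :
    regularPolygonVertex (2 * (s + 1)) (polygonRadius s) j = polygonPoint s j := by
  have : 2 * Real.pi * ((j : ℕ) : ℝ) / ((2 * (s + 1) : ℕ) : ℝ) =
      (j : ℕ) * Real.pi / ((s : ℝ) + 1) := by
    push_cast; field_simp
  rw [regularPolygonVertex, polygonPoint, this]

theorem regularPolygonVertex_add (s : ℕ) (j : Fin (s + 1)) :
    regularPolygonVertex (2 * (s + 1)) (polygonRadius s) (s + 1 + j) = -polygonPoint s j := by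
  have : 2 * Real.pi * ((s + 1 + j : ℕ) : ℝ) / ((2 * (s + 1) : ℕ) : ℝ) =
      (j : ℕ) * Real.pi / ((s : ℝ) + 1) + Real.pi := by
    push_cast; field_simp; ring
  rw [regularPolygonVertex, polygonPoint, this, Real.cos_add_pi, Real.sin_add_pi]
  ext i
  fin_cases i <;> simp

theorem range_polygonPoint_union_neg (s : ℕ) :
    Set.range (polygonPoint s) ∪ Set.range (fun j => -polygonPoint s j) =
      Set.range (fun k : Fin (2 * (s + 1)) =>
        regularPolygonVertex (2 * (s + 1)) (polygonRadius s) k) := by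
  ext p
  constructor
  · rintro (⟨j, rfl⟩ | ⟨j, rfl⟩)
    · exact ⟨⟨j, by omega⟩, regularPolygonVertex_of_lt s j⟩
    · exact ⟨⟨s + 1 + j, by omega⟩, regularPolygonVertex_add s j⟩
  · rintro ⟨k, rfl⟩
    by_cases hk : (k : ℕ) < s + 1
    · exact Or.inl ⟨⟨k, hk⟩, (regularPolygonVertex_of_lt s ⟨k, hk⟩).symm⟩
    · refine Or.inr ⟨⟨k - (s + 1), by omega⟩, ?_⟩
      refine (regularPolygonVertex_add s ⟨k - (s + 1), by omega⟩).symm.trans ?_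
      have : s + 1 + ((k : ℕ) - (s + 1)) = k := by omega
      simp only [this]

theorem mainTheorem4 (s : ℕ) (hs : 1 ≤ s) :
    -- the points of the real decomposition and their opposites are the vertices of a regular
    -- `2(s+1)`-gon of radius `r`
    (Set.range (polygonPoint s) ∪ Set.range (fun j => -polygonPoint s j) =
      Set.range (fun k : Fin (2 * (s + 1)) =>
        regularPolygonVertex (2 * (s + 1)) (polygonRadius s) k)) ∧
    -- they give a decomposition of `q_2^s`, and it is minimal
    IsMinimalDecomposition (2 * s) (quadForm 2 ^ s)
      (fun j : Fin (s + 1) => toComplexPoint (polygonPoint s j)) ∧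
    -- the minimal decompositions are exactly its images under `O_2(ℂ)`
    (∀ (m : ℕ) (a : Fin m → Fin 2 → ℂ),
      IsMinimalDecomposition (2 * s) (quadForm 2 ^ s) a ↔
        ∃ A ∈ Matrix.orthogonalGroup (Fin 2) ℂ, ∃ e : Fin m ≃ Fin (s + 1),
          ∀ j, linForm (a j) ^ (2 * s) =
            matrixAct A (linForm (toComplexPoint (polygonPoint s (e j))) ^ (2 * s))) := by
  refine ⟨range_polygonPoint_union_neg s,
    (isMinimalDecomposition_iff_isDecomposition s hs _).mpr
      ⟨isDecomposition_polygonPoint s hs, rfl⟩, fun m a => ?_⟩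
  rw [isMinimalDecomposition_iff_isDecomposition s hs]
  constructor
  · rintro ⟨h, rfl⟩
    obtain ⟨t, ht, e, he⟩ := exists_isoRotation_of_isDecomposition s hs a h
    refine ⟨isoRotation t, isoRotation_mem_orthogonalGroup ht, e, fun j => ?_⟩
    rw [matrixAct_pow, matrixAct_linForm, he j]
  · rintro ⟨A, hA, e, he⟩
    refine ⟨?_, by simpa using Fintype.card_congr e⟩
    have h : quadForm 2 ^ s = _ := isDecomposition_polygonPoint s hs
    -- `q₂` is invariant under `A`, so applying `A` to the polygon's decomposition gives another
    -- one.
    have h' := congrArg (matrixAct A) h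
    rw [matrixAct_pow, matrixAct_quadForm hA, matrixAct_sum] at h'
    rw [IsDecomposition, h', Finset.sum_congr rfl fun j _ => he j]
    exact (Equiv.sum_comp e fun j =>
      matrixAct A (linForm (toComplexPoint (polygonPoint s j)) ^ (2 * s))).symm
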